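/- Let $G$ be a group with identity $e$, let $\sigma:G\to G$ be an involutive anti-automorphism (that is, $\sigma(xy)=\sigma(y)\sigma(x)$ and $\sigma(\sigma(x))=x$ for all $x,y\in G$), and let $\chi:G\to\mathbb C^*$ be a character (group homomorphism) with $\chi(x\sigma(x))=1$ for all $x\in G$. Let $f,g:G\to\mathbb C$ satisfy $$(E)\qquad f(xy)+\chi(y)f(\sigma(y)x)=2f(x)g(y),\qquad x,y\in G,$$ with $f\neq 0$. Put $m_g(x)=2g(x)^2-g(x^2)$ and $\check g(x)=g(x^{-1})$. A function $h:G\to\mathbb C$ is called central if $h(xy)=h(yx)$ for all $x,y\in G$, abelian if $h(x_{\pi(1)}\cdots x_{\pi(n)})=h(x_1\cdots x_n)$ for all $n$, all $x_1,\dots,x_n\in G$ and all permutations $\pi$ of $\{1,\dots,n\}$, and odd if $h=-\chi\, h\circ\sigma$. Put $f_e=\frac{f+\chi f\circ\sigma}{2}$ and $f_o=\frac{f-\chi f\circ\sigma}{2}$. Then the following hold. **(1)** Suppose that $f$ is central. (i) If $g$ is not abelian, then $f=f(e)g$. (ii) If $g$ is abelian, then there is a character $\psi:G\to\mathbb C^*$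 such that $g=\frac{\psi+\chi\psi\circ\sigma}{2}$ and: if $\psi\neq\chi\psi\circ\sigma$, then $f=\alpha\frac{\psi-\chi\psi\circ\sigma}{2}+\beta\frac{\psi+\chi\psi\circ\sigma}{2}$ for some $\alpha,\beta\in\mathbb C$; if $\psi=\chi\psi\circ\sigma$, then $f=\psi a+\beta\psi$ for some additive map $a:G\to\mathbb C$ (that is, $a(xy)=a(x)+a(y)$ for all $x,y\in G$) and some $\beta\in\mathbb C$. **(2)** In general: (i) $g(e)=1$, $g$ is central, $g=\chi\, g\circ\sigma$, and $g=m_g\,\check g$. (ii) $m_g$ takes values in $\mathbb C^*$ and is multiplicative. (iii) $\chi(y)f(\sigma(y)xy)=m_g(y)f(x)$ and $\chi(y)f(\sigma(y)x)=m_g(y)f(xy^{-1})$ for all $x,y\in G$. (iv) $g(xy)+m_g(y)g(xy^{-1})=2g(x)g(y)$ for all $x,y\in G$. (v) $f(xy)+m_g(y)f(xy^{-1})=2f(x)g(y)$ for all $x,y\in G$. (vi) $f=-\chi f\circ\sigma$ if and only if $f(e)=0$. (vii) Each of $f_e$, $f_o$ and $\chi f\circ\sigma$ satisfies $(E)$ in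 place of $f$, with $g$ unchanged. (viii) $f_e=f(e)g$. In particular, $f_e=0$ if and only if $f(e)=0$. (ix) $f_o(xy)+f_o(yx)=2f_o(x)g(y)+2f_o(y)g(x)$ for all $x,y\in G$. **(3)** Suppose in addition that $\sigma(x)=x^{-1}$ for all $x\in G$. Then $\chi(x^{-1})m_g(x)\in\{-1,1\}$ for all $x\in G$. If $m_g=\chi$, then either $g$ is not abelian and $f=f(e)g$, or $f$ and $g$ are both abelian, in which case $f$ is central and $f,g$ have the form described in (1)(ii). **(4)** Suppose in addition that $\sigma(x)=x^{-1}$ for all $x\in G$. If $m_g\neq\chi$, then $f$ is odd, that is, $f=-\chi f\circ\sigma$. -/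

import Mathlib

namespace WilsonVariant

/-- The pair `(f, g)` solves `f(xy) + χ(y) f(σ(y)x) = 2 f(x) g(y)` on `G`. -/
def IsSolution {G : Type*} [Group G] (χ : G →* ℂˣ) (σ : G → G) (f g : G → ℂ) : Prop :=
  ∀ x y : G, f (x * y) + (χ y : ℂ) * f (σ y * x) = 2 * f x * g y

/-- `f(xy) = f(yx)` for all `x, y`. -/
def IsCentral {G : Type*} [Group G] (f : G → ℂ) : Prop :=
  ∀ x y : G, f (x * y) = f (y * x)

/-- `f(x_{π(1)} ⋯ x_{π(n)}) = f(x_1 ⋯ x_n)` for all `n`, all `x_1, …, x_n ∈ G` and all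
permutations `π`. -/
def IsAbelian {G : Type*} [Group G] (f : G → ℂ) : Prop :=
  ∀ (n : ℕ) (x : Fin n → G) (π : Equiv.Perm (Fin n)),
    f (List.ofFn fun i => x (π i)).prod = f (List.ofFn x).prod

/-- The function `m_g(x) = 2 g(x)² - g(x²)`. -/
def mFun {G : Type*} [Group G] (g : G → ℂ) (x : G) : ℂ :=
  2 * g x ^ 2 - g (x ^ 2)

/-- The function `χ · (f ∘ σ)`. -/
def twist {G : Type*} [Group G] (χ : G →* ℂˣ) (σ : G → G) (f : G → ℂ) (x : G) : ℂ :=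
  (χ x : ℂ) * f (σ x)

/-- The even part `f_e = (f + χ · (f ∘ σ)) / 2`. -/
noncomputable def evenPart {G : Type*} [Group G] (χ : G →* ℂˣ) (σ : G → G) (f : G → ℂ)
    (x : G) : ℂ :=
  (f x + (χ x : ℂ) * f (σ x)) / 2

/-- The odd part `f_o = (f - χ · (f ∘ σ)) / 2`. -/
noncomputable def oddPart {G : Type*} [Group G] (χ : G →* ℂˣ) (σ : G → G) (f : G → ℂ)
    (x : G) : ℂ :=
  (f x - (χ x : ℂ) * f (σ x)) / 2

/-- `f = - χ · (f ∘ σ)`. -/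
def IsOdd {G : Type*} [Group G] (χ : G →* ℂˣ) (σ : G → G) (f : G → ℂ) : Prop :=
  ∀ x : G, f x = -((χ x : ℂ) * f (σ x))

/-- The explicit form of `(f, g)`: for some character `ψ`, `g = (ψ + χ · (ψ ∘ σ)) / 2`;
if `ψ ≠ χ · (ψ ∘ σ)` then `f = α (ψ - χ · (ψ ∘ σ)) / 2 + β (ψ + χ · (ψ ∘ σ)) / 2` for some
constants `α, β`; if `ψ = χ · (ψ ∘ σ)` then `f = ψ a + β ψ` for some additive `a : G → ℂ` and some
constant `β`. -/
def HasCharacterForm {G : Type*} [Group G] (χ : G →* ℂˣ) (σ : G → G) (f g : G → ℂ) : Prop :=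
  ∃ ψ : G →* ℂˣ,
    (∀ x : G, g x = ((ψ x : ℂ) + (χ x : ℂ) * (ψ (σ x) : ℂ)) / 2) ∧
    ((¬ ∀ x : G, (ψ x : ℂ) = (χ x : ℂ) * (ψ (σ x) : ℂ)) →
      ∃ α β : ℂ, ∀ x : G,
        f x = α * (((ψ x : ℂ) - (χ x : ℂ) * (ψ (σ x) : ℂ)) / 2)
          + β * (((ψ x : ℂ) + (χ x : ℂ) * (ψ (σ x) : ℂ)) / 2)) ∧
    ((∀ x : G, (ψ x : ℂ) = (χ x : ℂ) * (ψ (σ x) : ℂ)) →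
      ∃ (a : G → ℂ) (β : ℂ), (∀ x y : G, a (x * y) = a x + a y) ∧
        ∀ x : G, f x = (ψ x : ℂ) * a x + β * (ψ x : ℂ))

end WilsonVariant

/-!
Write `R(y) f = f(· y)` and `ρ(y) f = χ(y) f(σ(y) ·)`. These are commuting representations of `G`,
and the equation says `R(y) f + ρ(y) f = 2 g(y) f`. Expanding `ρ(yz) f = ρ(y) ρ(z) f` by means of
it eliminates `ρ` and leaves
`R(yz) f + R(zy) f = 2 g(z) R(y) f + 2 g(y) R(z) f + (2 g(yz) - 4 g(y) g(z)) f`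
(`IsSolution.mul_add_mul_swap`). Symmetry in `y, z` makes `g` central; the diagonal `y = z` gives
`R(y) f + m_g(y) R(y⁻¹) f = 2 g(y) f`, whence `ρ(y) f = m_g(y) R(y⁻¹) f`; that both sides of the
latter are compatible with products forces `m_g` to be multiplicative.

The twist `χ · (f ∘ σ)` is again a solution, so `f` splits into an even part, which is `f(1) g`
(put `x = 1`), and an odd part. An odd solution `F` satisfies
`F(xy) + F(yx) = 2 F(x) g(y) + 2 F(y) g(x)` (`IsSolution.symmetrized_sine`), and the same holds with
`g` replaced by `χ · (g ∘ σ)`; comparing the two shows `g = χ · (g ∘ σ)`.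

If `f` is central and `F = f_o ≠ 0`, then `F(xy) = F(x) g(y) + F(y) g(x)`, the sine addition law.
Associativity turns this into `g(xy) = g(x) g(y) + b² F(x) F(y)` for some `b`, and then `g + b F` and
`g - b F` are characters, which yields the explicit form and shows that `g` is abelian
(`hasCharacterForm_of_sine`). If `f_o = 0` and `g` is abelian, then `F(x) = g(xz) - g(x) g(z)`
satisfies the sine addition law for each `z`, so that the same lemma applies unless `g` is itself
a character. When `σ` is the inversion, `χ(y) f(y⁻¹xy) = m_g(y) f(x)`: if `m_g = χ` then `f` is
central, and if `m_g ≠ χ` then `f(1) = 0`.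
-/

namespace WilsonVariant

variable {G : Type*} [Group G] {σ : G → G} {χ : G →* ℂˣ} {f g F : G → ℂ}

/-! ### Abelian functions -/

lemma map_prod_ofFn_perm {A : Type*} [CommMonoid A] (φ : G →* A) (n : ℕ) (x : Fin n → G)
    (π : Equiv.Perm (Fin n)) :
    φ (List.ofFn fun i => x (π i)).prod = φ (List.ofFn x).prod := by
  rw [map_list_prod, map_list_prod, List.map_ofFn, List.map_ofFn, List.prod_ofFn, List.prod_ofFn]
  exact Equiv.prod_comp π fun i => φ (x i)

lemma IsAbelian.mul_right_comm (hg : IsAbelian g) (x y z : G) :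
    g (x * y * z) = g (x * z * y) := by
  have h := hg 3 ![x, z, y] (Equiv.swap 1 2)
  have h0 : Equiv.swap (1 : Fin 3) 2 0 = 0 := by decide
  have h1 : Equiv.swap (1 : Fin 3) 2 1 = 2 := by decide
  have h2 : Equiv.swap (1 : Fin 3) 2 2 = 1 := by decide
  simpa [List.ofFn_succ, h0, h1, h2, mul_assoc] using h

/-- An anti-automorphism composed with a homomorphism to a commutative group is a homomorphism, so
the explicit form only involves functions that factor through the abelianization. -/
lemma HasCharacterForm.isAbelian (hσ : ∀ x y : G, σ (x * y) = σ y * σ x)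
    (h : HasCharacterForm χ σ f g) : IsAbelian f ∧ IsAbelian g := by
  obtain ⟨ψ, hg, h1, h2⟩ := h
  let ψ' : G →* ℂˣ := MonoidHom.mk' (fun x => ψ (σ x)) fun x y => by
    rw [hσ, map_mul, mul_comm]
  have hψ : ∀ n (x : Fin n → G) (π : Equiv.Perm (Fin n)),
      ψ (σ (List.ofFn fun i => x (π i)).prod) = ψ (σ (List.ofFn x).prod) :=
    map_prod_ofFn_perm ψ'
  refine ⟨fun n x π => ?_, fun n x π => ?_⟩
  · by_cases hc : ∀ x : G, (ψ x : ℂ) = (χ x : ℂ) * (ψ (σ x) : ℂ)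
    · obtain ⟨a, β, ha, hf⟩ := h2 hc
      let a' : G →* Multiplicative ℂ := MonoidHom.mk' (fun x => Multiplicative.ofAdd (a x))
        fun x y => by rw [ha, ofAdd_add]
      have haπ : a (List.ofFn fun i => x (π i)).prod = a (List.ofFn x).prod :=
        Multiplicative.ofAdd.injective (map_prod_ofFn_perm a' n x π)
      rw [hf, hf, haπ, map_prod_ofFn_perm ψ]
    · obtain ⟨α, β, hf⟩ := h1 hc
      rw [hf, hf, hψ, map_prod_ofFn_perm ψ, map_prod_ofFn_perm χ]
  · rw [hg, hg, hψ, map_prod_ofFn_perm ψ, map_prod_ofFn_perm χ]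

/-! ### Consequences of the functional equation for `g` and `m_g` -/

namespace IsSolution

/-- The equation with the left translations eliminated. -/
lemma mul_add_mul_swap (hσ : ∀ x y : G, σ (x * y) = σ y * σ x) (h : IsSolution χ σ f g)
    (x y z : G) :
    f (x * y * z) + f (x * z * y) =
      2 * g z * f (x * y) + 2 * g y * f (x * z) + (2 * g (y * z) - 4 * g y * g z) * f x := by
  have h1 := h x (y * z)
  have h2 := h (σ y * x) z
  have h3 := h (x * z) y
  have h4 := h x y
  rw [hσ, map_mul, Units.val_mul] at h1
  simp only [mul_assoc] at h1 h2 h3 h4 ⊢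
  linear_combination h1 - (χ y : ℂ) * h2 + h3 - 2 * g z * h4

lemma map_one_right (hσ : ∀ x y : G, σ (x * y) = σ y * σ x) (h : IsSolution χ σ f g)
    (hf : f ≠ 0) : g 1 = 1 := by
  obtain ⟨t, ht⟩ := Function.ne_iff.1 hf
  have hσ1 : σ 1 = 1 := by simpa using hσ 1 1
  have h1 := h t 1
  simp only [hσ1, mul_one, one_mul, map_one, Units.val_one] at h1
  exact mul_left_cancel₀ ht (by linear_combination -h1 / 2)

lemma isCentral_right (hσ : ∀ x y : G, σ (x * y) = σ y * σ x) (h : IsSolution χ σ f g)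
    (hf : f ≠ 0) : IsCentral g := fun y z => by
  obtain ⟨t, ht⟩ := Function.ne_iff.1 hf
  have h1 := h.mul_add_mul_swap hσ t y z
  have h2 := h.mul_add_mul_swap hσ t z y
  exact mul_right_cancel₀ ht (by linear_combination (h2 - h1) / 2)

lemma mul_add_mFun_mul_inv (hσ : ∀ x y : G, σ (x * y) = σ y * σ x) (h : IsSolution χ σ f g)
    (x y : G) : f (x * y) + mFun g y * f (x * y⁻¹) = 2 * f x * g y := by
  have h1 := h.mul_add_mul_swap hσ (x * y⁻¹) y y
  simp only [inv_mul_cancel_right] at h1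
  rw [mFun, pow_two y]
  linear_combination h1 / 2

lemma translate_left (hσ : ∀ x y : G, σ (x * y) = σ y * σ x) (h : IsSolution χ σ f g)
    (x y : G) : (χ y : ℂ) * f (σ y * x) = mFun g y * f (x * y⁻¹) := by
  linear_combination h x y - h.mul_add_mFun_mul_inv hσ x y

lemma conj (hσ : ∀ x y : G, σ (x * y) = σ y * σ x) (h : IsSolution χ σ f g)
    (x y : G) : (χ y : ℂ) * f (σ y * x * y) = mFun g y * f x := by
  have h1 := h.translate_left hσ (x * y) y
  rwa [mul_inv_cancel_right, ← mul_assoc] at h1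

lemma mFun_mul (hσ : ∀ x y : G, σ (x * y) = σ y * σ x) (h : IsSolution χ σ f g) (hf : f ≠ 0)
    (x y : G) : mFun g (x * y) = mFun g x * mFun g y := by
  obtain ⟨t, ht⟩ := Function.ne_iff.1 hf
  have h1 := h.conj hσ t (x * y)
  have h2 := h.conj hσ (σ x * t * x) y
  have h3 := h.conj hσ t x
  rw [hσ, map_mul, Units.val_mul] at h1
  simp only [mul_assoc] at h1 h2 h3
  exact mul_right_cancel₀ ht (by linear_combination -h1 + (χ x : ℂ) * h2 + mFun g y * h3)

lemma mFun_ne_zero (hσ : ∀ x y : G, σ (x * y) = σ y * σ x) (h : IsSolution χ σ f g) (hf : f ≠ 0)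
    (x : G) : mFun g x ≠ 0 := by
  have h1 := h.mFun_mul hσ hf x x⁻¹
  have h2 : mFun g 1 = 1 := by
    norm_num [mFun, h.map_one_right hσ hf]
  rw [mul_inv_cancel, h2] at h1
  exact left_ne_zero_of_mul (h1 ▸ one_ne_zero)

lemma dAlembert (hσ : ∀ x y : G, σ (x * y) = σ y * σ x) (h : IsSolution χ σ f g) (hf : f ≠ 0)
    (x y : G) : g (x * y) + mFun g y * g (x * y⁻¹) = 2 * g x * g y := by
  obtain ⟨t, ht⟩ := Function.ne_iff.1 hf
  have hc := h.isCentral_right hσ hf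
  have hm := h.mFun_mul hσ hf
  have E := h.mul_add_mFun_mul_inv hσ
  have hinv : mFun g y * mFun g y⁻¹ = 1 := by
    rw [← hm, mul_inv_cancel]; norm_num [mFun, h.map_one_right hσ hf]
  -- `g(xy)` and `g(xy⁻¹)` are each expanded in both orders; only the sum of the four
  -- expansions regroups into translates of `R(y) f + m_g(y) R(y⁻¹) f`.
  have a1 := E t (x * y)
  have a2 := E t (y * x)
  have a3 := E t (x * y⁻¹)
  have a4 := E t (y⁻¹ * x)
  have b1 := E (t * x) y
  have b2 := E (t * y) x
  have b3 := E (t * y⁻¹) x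
  have b4 := E (t * x⁻¹) y
  have c1 := E t x
  have c2 := E t y
  rw [hm] at a1 a2 a3 a4
  rw [hc y x] at a2
  rw [hc y⁻¹ x] at a4
  simp only [mul_inv_rev, inv_inv, ← mul_assoc] at a1 a2 a3 a4 b1 b2 b3 b4
  refine mul_left_cancel₀ ht ?_
  linear_combination (b1 + b2 + mFun g y * b3 + mFun g x * b4 + 2 * g y * c1 + 2 * g x * c2
    - a1 - a2 - mFun g y * (a3 + a4)
    + mFun g x * (f (t * y * x⁻¹) + f (t * x⁻¹ * y)) * hinv) / 4

/-! ### Even and odd parts -/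

lemma twist (hσ : ∀ x y : G, σ (x * y) = σ y * σ x) (hσσ : ∀ x : G, σ (σ x) = x)
    (hχ : ∀ x : G, χ (x * σ x) = 1) (h : IsSolution χ σ f g) :
    IsSolution χ σ (twist χ σ f) g := fun x y => by
  have h1 := h (σ x) y
  have h2 : (χ y : ℂ) * χ (σ y) = 1 := by
    rw [← Units.val_mul, ← map_mul, hχ, Units.val_one]
  simp only [WilsonVariant.twist, hσ, hσσ, map_mul, Units.val_mul]
  linear_combination (χ x : ℂ) * h1 + (χ x : ℂ) * f (σ x * y) * h2

lemma evenPart (hσ : ∀ x y : G, σ (x * y) = σ y * σ x) (hσσ : ∀ x : G, σ (σ x) = x)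
    (hχ : ∀ x : G, χ (x * σ x) = 1) (h : IsSolution χ σ f g) :
    IsSolution χ σ (evenPart χ σ f) g := fun x y => by
  have h1 := h x y
  have h2 := h.twist hσ hσσ hχ x y
  simp only [WilsonVariant.twist] at h2
  simp only [WilsonVariant.evenPart]
  linear_combination (h1 + h2) / 2

lemma oddPart (hσ : ∀ x y : G, σ (x * y) = σ y * σ x) (hσσ : ∀ x : G, σ (σ x) = x)
    (hχ : ∀ x : G, χ (x * σ x) = 1) (h : IsSolution χ σ f g) :
    IsSolution χ σ (oddPart χ σ f) g := fun x y => by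
  have h1 := h x y
  have h2 := h.twist hσ hσσ hχ x y
  simp only [WilsonVariant.twist] at h2
  simp only [WilsonVariant.oddPart]
  linear_combination (h1 - h2) / 2

lemma evenPart_eq (h : IsSolution χ σ f g) (x : G) :
    WilsonVariant.evenPart χ σ f x = f 1 * g x := by
  have h1 := h 1 x
  rw [one_mul, mul_one] at h1
  rw [WilsonVariant.evenPart, h1]
  ring

end IsSolution

lemma evenPart_add_oddPart (x : G) : evenPart χ σ f x + oddPart χ σ f x = f x := by
  simp only [evenPart, oddPart]
  ring

lemma isOdd_oddPart (hσσ : ∀ x : G, σ (σ x) = x) (hχ : ∀ x : G, χ (x * σ x) = 1) :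
    IsOdd χ σ (oddPart χ σ f) := fun x => by
  have h2 : (χ x : ℂ) * χ (σ x) = 1 := by
    rw [← Units.val_mul, ← map_mul, hχ, Units.val_one]
  simp only [oddPart, hσσ]
  linear_combination -f x / 2 * h2

lemma IsCentral.oddPart (hσ : ∀ x y : G, σ (x * y) = σ y * σ x) (hc : IsCentral f) :
    IsCentral (oddPart χ σ f) := fun x y => by
  simp only [WilsonVariant.oddPart, hσ, map_mul, Units.val_mul, hc x y, hc (σ y) (σ x)]
  ring

namespace IsSolution

lemma symmetrized_sine (hσ : ∀ x y : G, σ (x * y) = σ y * σ x) (hσσ : ∀ x : G, σ (σ x) = x)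
    (hχ : ∀ x : G, χ (x * σ x) = 1) (h : IsSolution χ σ F g) (hodd : IsOdd χ σ F) (x y : G) :
    F (x * y) + F (y * x) = 2 * F x * g y + 2 * F y * g x := by
  have h1 := h x y
  have h2 := h y x
  have h3 := hodd (σ x * y)
  have h4 : (χ x : ℂ) * χ (σ x) = 1 := by
    rw [← Units.val_mul, ← map_mul, hχ, Units.val_one]
  simp only [hσ, hσσ, map_mul, Units.val_mul] at h3
  linear_combination h1 + h2 - (χ x : ℂ) * h3 + (χ y : ℂ) * F (σ y * x) * h4

/-- The equation at `σ y` gives the mirrored equation `f(yx) + χ(y) f(xσ(y)) = 2 f(x) g'(y)` with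
`g' = χ · (g ∘ σ)`, and for odd `F` this leads to the symmetrized sine law with `g'`. -/
lemma symmetrized_sine_twist (hσ : ∀ x y : G, σ (x * y) = σ y * σ x)
    (hσσ : ∀ x : G, σ (σ x) = x)
    (hχ : ∀ x : G, χ (x * σ x) = 1) (h : IsSolution χ σ F g) (hodd : IsOdd χ σ F) (x y : G) :
    F (x * y) + F (y * x) =
      2 * F x * WilsonVariant.twist χ σ g y + 2 * F y * WilsonVariant.twist χ σ g x := by
  have hc : ∀ z, (χ z : ℂ) * χ (σ z) = 1 := fun z => by
    rw [← Units.val_mul, ← map_mul, hχ, Units.val_one]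
  have h1 := h x (σ y)
  have h2 := h y (σ x)
  have h3 := hodd (y * σ x)
  simp only [hσ, hσσ, map_mul, Units.val_mul] at h1 h2 h3
  simp only [WilsonVariant.twist]
  linear_combination (χ y : ℂ) * h1 + (χ x : ℂ) * h2 - F (y * x) * hc y - F (x * y) * hc x
    - (χ x : ℂ) * h3 + (χ y : ℂ) * F (x * σ y) * hc x

lemma twist_right (hσ : ∀ x y : G, σ (x * y) = σ y * σ x) (hσσ : ∀ x : G, σ (σ x) = x)
    (hχ : ∀ x : G, χ (x * σ x) = 1) (h : IsSolution χ σ f g) (hf : f ≠ 0) (x : G) :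
    g x = (χ x : ℂ) * g (σ x) := by
  have hc : (χ x : ℂ) * χ (σ x) = 1 := by
    rw [← Units.val_mul, ← map_mul, hχ, Units.val_one]
  by_cases h1 : f 1 = 0
  · have hodd : IsOdd χ σ f := fun y => by
      have h2 := h.evenPart_eq y
      rw [h1, WilsonVariant.evenPart] at h2
      linear_combination 2 * h2
    obtain ⟨t, ht⟩ := Function.ne_iff.1 hf
    have A := h.symmetrized_sine hσ hσσ hχ hodd
    have B := h.symmetrized_sine_twist hσ hσσ hχ hodd
    -- The difference `d` of the two candidates satisfies `f(x) d(y) + f(y) d(x) = 0`.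
    have h2 : g t - WilsonVariant.twist χ σ g t = 0 :=
      mul_left_cancel₀ ht (by linear_combination (B t t - A t t) / 4)
    have h3 : g x - WilsonVariant.twist χ σ g x = 0 :=
      mul_left_cancel₀ ht (by linear_combination (B t x - A t x) / 2 - f x * h2)
    exact sub_eq_zero.1 h3
  · have h2 := h.evenPart_eq x
    have h3 := h.evenPart_eq (σ x)
    simp only [WilsonVariant.evenPart, hσσ] at h2 h3
    exact mul_left_cancel₀ h1 (by linear_combination (χ x : ℂ) * h3 - h2 - f x / 2 * hc)

lemma isOdd_iff (hσ : ∀ x y : G, σ (x * y) = σ y * σ x) (h : IsSolution χ σ f g) :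
    IsOdd χ σ f ↔ f 1 = 0 := by
  refine ⟨fun ho => ?_, fun h1 x => ?_⟩
  · have hσ1 : σ 1 = 1 := by simpa using hσ 1 1
    have h1 := ho 1
    rw [hσ1, map_one, Units.val_one] at h1
    linear_combination h1 / 2
  · have h2 := h.evenPart_eq x
    rw [h1, WilsonVariant.evenPart] at h2
    linear_combination 2 * h2

end IsSolution

/-! ### The sine addition law and the explicit form -/

/-- A multiplicative function with value `1` at the identity, as a character. -/
noncomputable def characterOfMul (p : G → ℂ) (h1 : p 1 = 1)
    (hmul : ∀ x y, p (x * y) = p x * p y) : G →* ℂˣ :=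
  MonoidHom.toHomUnits { toFun := p, map_one' := h1, map_mul' := hmul }

@[simp]
lemma coe_characterOfMul (p : G → ℂ) (h1 : p 1 = 1) (hmul : ∀ x y, p (x * y) = p x * p y)
    (x : G) : (characterOfMul p h1 hmul x : ℂ) = p x := rfl

/-- A nonzero odd solution `F` of the sine addition law with even companion `g` forces the explicit
form on every linear combination of `F` and `g`. -/
lemma hasCharacterForm_of_sine (hF : F ≠ 0) (hodd : IsOdd χ σ F) (hF1 : F 1 = 0)
    (hg1 : g 1 = 1) (heven : ∀ x, g x = (χ x : ℂ) * g (σ x))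
    (hsin : ∀ x y, F (x * y) = F x * g y + F y * g x) (κ β : ℂ) :
    HasCharacterForm χ σ (fun x => κ * F x + β * g x) g := by
  obtain ⟨t, ht⟩ := Function.ne_iff.1 hF
  replace ht : F t ≠ 0 := ht
  -- Expanding `F(xyz)` in two ways.
  have assoc (x y z : G) : F x * (g (y * z) - g y * g z) = F z * (g (x * y) - g x * g y) := by
    have h1 := hsin (x * y) z
    have h2 := hsin x (y * z)
    rw [mul_assoc] at h1
    linear_combination h1 - h2 + g z * hsin x y - g x * hsin y z
  obtain ⟨b, hb⟩ : ∃ b : ℂ, b ^ 2 = (g (t * t) - g t * g t) / F t ^ 2 :=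
    IsAlgClosed.exists_pow_nat_eq _ two_pos
  have hbt : b ^ 2 * F t ^ 2 = g (t * t) - g t * g t := by
    rw [hb]; field_simp
  have hcos (x y : G) : g (x * y) = g x * g y + b ^ 2 * F x * F y := by
    refine mul_left_cancel₀ (pow_ne_zero 2 ht) ?_
    linear_combination -F t * assoc x y t - F x * assoc y t t - F x * F y * hbt
  let ψ : G →* ℂˣ := characterOfMul (fun x => g x + b * F x) (by simp [hF1, hg1])
    fun x y => by linear_combination hcos x y + b * hsin x y
  have hψ (x : G) : (ψ x : ℂ) = g x + b * F x := rfl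
  have hψσ (x : G) : (χ x : ℂ) * ψ (σ x) = g x - b * F x := by
    rw [hψ]; linear_combination -heven x + b * hodd x
  refine ⟨ψ, fun x => by rw [hψσ, hψ]; ring, fun hne => ?_, fun heq => ?_⟩
  · have hb0 : b ≠ 0 := fun h0 => hne fun x => by rw [hψσ, hψ, h0]; ring
    refine ⟨κ / b, β, fun x => ?_⟩
    rw [hψσ, hψ]
    field_simp
    ring
  · have hb0 : b = 0 := by
      have h1 := heq t
      rw [hψσ, hψ] at h1
      exact mul_right_cancel₀ ht (by linear_combination h1 / 2)
    have hψg (x : G) : (ψ x : ℂ) = g x := by rw [hψ, hb0]; ring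
    have hg0 (x : G) : g x ≠ 0 := hψg x ▸ (ψ x).ne_zero
    refine ⟨fun x => κ * F x / g x, β, fun x y => ?_, fun x => ?_⟩
    · have hxy : g (x * y) = g x * g y := by rw [hcos, hb0]; ring
      have hx := hg0 x
      have hy := hg0 y
      simp only [hxy, hsin]
      field_simp
    · have hx := hg0 x
      rw [hψg]
      field_simp

/-- For abelian `g`, the function `x ↦ g(xz) - g(x) g(z)` obeys the sine addition law; if it
vanishes for every `z`, then `g` is a character. -/
lemma hasCharacterForm_of_isAbelian (hσ : ∀ x y : G, σ (x * y) = σ y * σ x)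
    (hσσ : ∀ x : G, σ (σ x) = x) (hχ : ∀ x : G, χ (x * σ x) = 1) (h : IsSolution χ σ g g)
    (hg1 : g 1 = 1) (hab : IsAbelian g) (heven : ∀ x, g x = (χ x : ℂ) * g (σ x)) (β : ℂ) :
    HasCharacterForm χ σ (fun x => β * g x) g := by
  by_cases hmul : ∀ x y, g (x * y) = g x * g y
  · refine ⟨characterOfMul g hg1 hmul, fun x => ?_, fun hne => (hne ?_).elim, fun _ => ?_⟩
    · simp only [coe_characterOfMul]; rw [← heven]; ring
    · exact heven
    · exact ⟨0, β, by simp, by simp⟩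
  · push Not at hmul
    obtain ⟨w, z, hwz⟩ := hmul
    let F : G → ℂ := fun x => g (x * z) - g x * g z
    have hFdef (x : G) : F x = g (x * z) - g x * g z := rfl
    have hF : F ≠ 0 := fun h0 => hwz (sub_eq_zero.1 (congrFun h0 w))
    have hodd : IsOdd χ σ F := fun x => by
      have h1 := h x z
      have h2 := heven (σ x * z)
      have h3 := heven (z * x)
      have hc : (χ x : ℂ) * χ (σ x) = 1 := by
        rw [← Units.val_mul, ← map_mul, hχ, Units.val_one]
      have h4 : g (z * x) = g (x * z) := by simpa using hab.mul_right_comm 1 z x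
      simp only [hσ, hσσ, map_mul, Units.val_mul] at h2 h3
      rw [hFdef, hFdef]
      linear_combination h1 + (χ x : ℂ) * h2 + (χ z : ℂ) * g (σ z * x) * hc + g z * heven x
    have hsin (x y : G) : F (x * y) = F x * g y + F y * g x := by
      have h1 := h.mul_add_mul_swap hσ x y z
      rw [hab.mul_right_comm x z y] at h1
      simp only [hFdef]
      linear_combination h1 / 2
    have key := hasCharacterForm_of_sine hF hodd (by simp [hFdef, hg1]) hg1 heven hsin 0 β
    simpa using key

/-- A central solution with nonzero odd part has the explicit form. -/
lemma IsSolution.hasCharacterForm_of_oddPart_ne_zero (hσ : ∀ x y : G, σ (x * y) = σ y * σ x)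
    (hσσ : ∀ x : G, σ (σ x) = x) (hχ : ∀ x : G, χ (x * σ x) = 1) (h : IsSolution χ σ f g)
    (hf : f ≠ 0) (hc : IsCentral f) (ho : WilsonVariant.oddPart χ σ f ≠ 0) :
    HasCharacterForm χ σ f g := by
  have hsol := h.oddPart hσ hσσ hχ
  have hodd : IsOdd χ σ (WilsonVariant.oddPart χ σ f) := isOdd_oddPart hσσ hχ
  have hsin (x y : G) : WilsonVariant.oddPart χ σ f (x * y) =
      WilsonVariant.oddPart χ σ f x * g y + WilsonVariant.oddPart χ σ f y * g x := by
    have h1 := hsol.symmetrized_sine hσ hσσ hχ hodd x y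
    rw [(hc.oddPart hσ) y x] at h1
    linear_combination h1 / 2
  have key := hasCharacterForm_of_sine ho hodd ((hsol.isOdd_iff hσ).1 hodd)
    (h.map_one_right hσ hf) (h.twist_right hσ hσσ hχ hf) hsin 1 (f 1)
  convert key using 2 with x
  rw [← evenPart_add_oddPart (χ := χ) (σ := σ) (f := f) x, h.evenPart_eq]
  ring

lemma IsSolution.eq_mul_of_oddPart_eq_zero (h : IsSolution χ σ f g)
    (ho : WilsonVariant.oddPart χ σ f = 0) (x : G) : f x = f 1 * g x := by
  rw [← h.evenPart_eq, ← evenPart_add_oddPart (χ := χ) (σ := σ) (f := f) x, ho, Pi.zero_apply,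
    add_zero]

lemma IsSolution.of_isCentral (hσ : ∀ x y : G, σ (x * y) = σ y * σ x)
    (hσσ : ∀ x : G, σ (σ x) = x) (hχ : ∀ x : G, χ (x * σ x) = 1) (h : IsSolution χ σ f g)
    (hf : f ≠ 0) (hc : IsCentral f) :
    (¬ IsAbelian g → ∀ x : G, f x = f 1 * g x) ∧
      (IsAbelian g → HasCharacterForm χ σ f g) := by
  by_cases ho : WilsonVariant.oddPart χ σ f = 0
  · have hfg := h.eq_mul_of_oddPart_eq_zero ho
    refine ⟨fun _ => hfg, fun hab => ?_⟩
    have h1 : f 1 ≠ 0 := fun h0 => hf (funext fun x => by rw [hfg, h0, zero_mul]; rfl)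
    have hgg : IsSolution χ σ g g := fun x y => by
      have h2 := h x y
      rw [hfg (x * y), hfg (σ y * x), hfg x] at h2
      exact mul_left_cancel₀ h1 (by linear_combination h2)
    have key := hasCharacterForm_of_isAbelian hσ hσσ hχ hgg (h.map_one_right hσ hf) hab
      (h.twist_right hσ hσσ hχ hf) (f 1)
    rwa [← funext hfg] at key
  · have key := h.hasCharacterForm_of_oddPart_ne_zero hσ hσσ hχ hf hc ho
    exact ⟨fun hab => (hab (key.isAbelian hσ).2).elim, fun _ => key⟩

/-! ### The case of the group inversion -/

lemma IsSolution.isCentral_of_mFun_eq (hσ : ∀ x y : G, σ (x * y) = σ y * σ x)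
    (h : IsSolution χ σ f g) (hinv : ∀ x, σ x = x⁻¹) (hm : ∀ x, mFun g x = (χ x : ℂ)) :
    IsCentral f := fun x y => by
  have h1 := h.conj hσ (y * x) y
  rw [hm, hinv, inv_mul_cancel_left] at h1
  exact mul_left_cancel₀ (χ y).ne_zero h1

lemma IsSolution.isOdd_of_mFun_ne (hσ : ∀ x y : G, σ (x * y) = σ y * σ x)
    (h : IsSolution χ σ f g) (hinv : ∀ x, σ x = x⁻¹) (hm : ¬ ∀ x, mFun g x = (χ x : ℂ)) :
    IsOdd χ σ f := by
  rw [h.isOdd_iff hσ]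
  by_contra h1
  refine hm fun y => mul_right_cancel₀ h1 ?_
  have h2 := h.conj hσ 1 y
  rw [hinv, mul_one, inv_mul_cancel] at h2
  exact h2.symm

/-- Since `g = χ · (g ∘ σ)`, also `m_g = χ² · (m_g ∘ σ)`, which for `σ(x) = x⁻¹` reads
`(m_g / χ)² = 1`. -/
lemma IsSolution.inv_mul_mFun_eq (hσ : ∀ x y : G, σ (x * y) = σ y * σ x)
    (hσσ : ∀ x : G, σ (σ x) = x) (hχ : ∀ x : G, χ (x * σ x) = 1) (h : IsSolution χ σ f g)
    (hf : f ≠ 0) (hinv : ∀ x, σ x = x⁻¹) (x : G) :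
    (χ x⁻¹ : ℂ) * mFun g x = 1 ∨ (χ x⁻¹ : ℂ) * mFun g x = -1 := by
  have hc : (χ x : ℂ) * χ x⁻¹ = 1 := by
    rw [← Units.val_mul, ← map_mul, mul_inv_cancel, map_one, Units.val_one]
  have hm : mFun g x * mFun g x⁻¹ = 1 := by
    rw [← h.mFun_mul hσ hf, mul_inv_cancel]; norm_num [mFun, h.map_one_right hσ hf]
  have h1 := h.twist_right hσ hσσ hχ hf x
  have h2 := h.twist_right hσ hσσ hχ hf (x ^ 2)
  simp only [hinv, map_pow, Units.val_pow_eq_pow_val, ← inv_pow] at h1 h2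
  have h3 : mFun g x = (χ x : ℂ) ^ 2 * mFun g x⁻¹ := by
    rw [mFun, mFun, h1, h2]; ring
  rw [← sq_eq_one_iff]
  linear_combination (χ x⁻¹ : ℂ) ^ 2 * mFun g x * h3 + (χ x : ℂ) ^ 2 * (χ x⁻¹ : ℂ) ^ 2 * hm
    + ((χ x : ℂ) * χ x⁻¹ + 1) * hc

end WilsonVariant

theorem theorem2p2 {G : Type*} [Group G] (σ : G → G)
    (hσ_anti : ∀ x y : G, σ (x * y) = σ y * σ x) (hσ_invol : ∀ x : G, σ (σ x) = x)
    (χ : G →* ℂˣ) (hχ : ∀ x : G, χ (x * σ x) = 1)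
    (f g : G → ℂ) (hfg : WilsonVariant.IsSolution χ σ f g) (hf : f ≠ 0) :
    -- (1) central solutions
    (WilsonVariant.IsCentral f →
      (¬ WilsonVariant.IsAbelian g → ∀ x : G, f x = f 1 * g x) ∧
      (WilsonVariant.IsAbelian g → WilsonVariant.HasCharacterForm χ σ f g)) ∧
    -- (2) general properties
    (g 1 = 1 ∧ WilsonVariant.IsCentral g ∧
      (∀ x : G, g x = (χ x : ℂ) * g (σ x)) ∧
      (∀ x : G, g x = WilsonVariant.mFun g x * g x⁻¹)) ∧
    ((∀ x : G, WilsonVariant.mFun g x ≠ 0) ∧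
      ∀ x y : G, WilsonVariant.mFun g (x * y) =
        WilsonVariant.mFun g x * WilsonVariant.mFun g y) ∧
    ((∀ x y : G, (χ y : ℂ) * f (σ y * x * y) = WilsonVariant.mFun g y * f x) ∧
      ∀ x y : G, (χ y : ℂ) * f (σ y * x) = WilsonVariant.mFun g y * f (x * y⁻¹)) ∧
    (∀ x y : G, g (x * y) + WilsonVariant.mFun g y * g (x * y⁻¹) = 2 * g x * g y) ∧
    (∀ x y : G, f (x * y) + WilsonVariant.mFun g y * f (x * y⁻¹) = 2 * f x * g y) ∧
    (WilsonVariant.IsOdd χ σ f ↔ f 1 = 0) ∧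
    (WilsonVariant.IsSolution χ σ (WilsonVariant.evenPart χ σ f) g ∧
      WilsonVariant.IsSolution χ σ (WilsonVariant.oddPart χ σ f) g ∧
      WilsonVariant.IsSolution χ σ (WilsonVariant.twist χ σ f) g) ∧
    ((∀ x : G, WilsonVariant.evenPart χ σ f x = f 1 * g x) ∧
      ((∀ x : G, WilsonVariant.evenPart χ σ f x = 0) ↔ f 1 = 0)) ∧
    (∀ x y : G,
      WilsonVariant.oddPart χ σ f (x * y) + WilsonVariant.oddPart χ σ f (y * x) =
        2 * WilsonVariant.oddPart χ σ f x * g y + 2 * WilsonVariant.oddPart χ σ f y * g x) ∧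
    -- (3), (4) the case of the group inversion
    ((∀ x : G, σ x = x⁻¹) →
      (∀ x : G, (χ x⁻¹ : ℂ) * WilsonVariant.mFun g x = 1 ∨
        (χ x⁻¹ : ℂ) * WilsonVariant.mFun g x = -1) ∧
      ((∀ x : G, WilsonVariant.mFun g x = (χ x : ℂ)) →
        (¬ WilsonVariant.IsAbelian g ∧ ∀ x : G, f x = f 1 * g x) ∨
        (WilsonVariant.IsAbelian f ∧ WilsonVariant.IsAbelian g ∧
          WilsonVariant.IsCentral f ∧ WilsonVariant.HasCharacterForm χ σ f g)) ∧
      ((¬ ∀ x : G, WilsonVariant.mFun g x = (χ x : ℂ)) →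
        WilsonVariant.IsOdd χ σ f)) := by
  have hg1 := hfg.map_one_right hσ_anti hf
  have hcentral := hfg.of_isCentral hσ_anti hσ_invol hχ hf
  refine ⟨hcentral, ⟨hg1, hfg.isCentral_right hσ_anti hf,
    hfg.twist_right hσ_anti hσ_invol hχ hf, fun x => ?_⟩,
    ⟨hfg.mFun_ne_zero hσ_anti hf, hfg.mFun_mul hσ_anti hf⟩,
    ⟨hfg.conj hσ_anti, hfg.translate_left hσ_anti⟩, hfg.dAlembert hσ_anti hf,
    hfg.mul_add_mFun_mul_inv hσ_anti, hfg.isOdd_iff hσ_anti,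
    ⟨hfg.evenPart hσ_anti hσ_invol hχ, hfg.oddPart hσ_anti hσ_invol hχ,
      hfg.twist hσ_anti hσ_invol hχ⟩, ⟨hfg.evenPart_eq, fun h => ?_, fun h x => ?_⟩,
    (hfg.oddPart hσ_anti hσ_invol hχ).symmetrized_sine hσ_anti hσ_invol hχ
      (WilsonVariant.isOdd_oddPart hσ_invol hχ),
    fun hinv => ⟨hfg.inv_mul_mFun_eq hσ_anti hσ_invol hχ hf hinv, fun hm => ?_,
      hfg.isOdd_of_mFun_ne hσ_anti hinv⟩⟩
  · have h1 := hfg.dAlembert hσ_anti hf 1 x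
    rw [one_mul, one_mul, hg1] at h1
    linear_combination -h1
  · have h1 := h 1
    rwa [hfg.evenPart_eq, hg1, mul_one] at h1
  · rw [hfg.evenPart_eq, h, zero_mul]
  · have hc := hfg.isCentral_of_mFun_eq hσ_anti hinv hm
    by_cases hab : WilsonVariant.IsAbelian g
    · have hform := (hcentral hc).2 hab
      exact Or.inr ⟨(hform.isAbelian hσ_anti).1, hab, hc, hform⟩
    · exact Or.inl ⟨hab, (hcentral hc).1 hab⟩
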